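/- For an open set $I\subseteq\mathbb{R}$, let $\mathcal{D}(I)$ be the space of smooth complex-valued test functions with compact support in $I$ and $\mathcal{D}'(I)$ the space of distributions on $I$. A distribution $f\in\mathcal{D}'(I)$ is a \emph{local pseudofunction} on $I$ if for every $\varphi\in\mathcal{D}(I)$ the Fourier transform of the compactly supported distribution $\varphi f$, that is, the function $\xi\mapsto\langle f(t),\varphi(t)e^{-i\xi t}\rangle$, is a continuous function on $\mathbb{R}$ that vanishes at $\pm\infty$. A harmonic function $U$ on the half-plane $\Re e\, s>1$ has \emph{local pseudofunction boundary behaviour} on $1+iI$ if there is a local pseudofunction $u\in\mathcal{D}'(I)$ such that $$\lim_{\sigma\to1^{+}}\int_{-\infty}^{\infty}U(\sigma+it)\varphi(t)\,\mathrm{d}t=\langle u(t),\varphi(t)\rangle\qquad\text{for every }\varphi\in\mathcal{D}(I).$$ Lemma. Let $U$ be a real-valued harmonic function on the half-plane $\Re e\, s>1$ and let $I\subseteq\mathbb{R}$ be open. If $U$ has local pseudofunction boundary behaviour on $1+iI$, then so does every harmonic conjugate of $U$, that is, every real-valued function $V$ on $\Re e\, s>1$ such that $U+iV$ is holomorphic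 there. -/

import Mathlib

open scoped Distributions

/-- The open half-plane `Re s > 1`. -/
def halfPlane : Set ℂ := {s : ℂ | 1 < s.re}

/-- The space `𝓓'(I)` of (complex) distributions on an open set `I ⊆ ℝ`: the `ℂ`-linear functionals
on the space `𝓓(I)` of complex-valued smooth test functions with compact support in `I`, continuous
for the canonical LF topology. -/
abbrev ComplexDistribution (I : TopologicalSpace.Opens ℝ) : Type := 𝓓(I, ℂ) →L[ℂ] ℂ

/-- The test function `t ↦ φ(t) e^{-iξt}`. -/
noncomputable def modulate {I : TopologicalSpace.Opens ℝ} (φ : 𝓓(I, ℂ)) (ξ : ℝ) : 𝓓(I, ℂ) where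
  toFun t := φ t * Complex.exp (-(Complex.I * ξ * t))
  contDiff' := φ.contDiff.mul
    ((contDiff_const.mul Complex.ofRealCLM.contDiff).neg.cexp)
  hasCompactSupport' := φ.hasCompactSupport.mul_right
  tsupport_subset' := (tsupport_mul_subset_left).trans φ.tsupport_subset

/-- The Fourier transform of the compactly supported distribution `φ f`, for `f ∈ 𝓓'(I)` and
`φ ∈ 𝓓(I)`. It is the function `ξ ↦ ⟨φ f, e^{-iξt}⟩ = ⟨f(t), φ(t) e^{-iξt}⟩`. -/
noncomputable def localizedFourier {I : TopologicalSpace.Opens ℝ} (f : ComplexDistribution I)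
    (φ : 𝓓(I, ℂ)) (ξ : ℝ) : ℂ :=
  f (modulate φ ξ)

/-- `f ∈ PF_loc(I)`: for every test function `φ` on `I`, the Fourier transform of `φ f` is a
continuous function that vanishes at `±∞`. -/
def IsLocalPseudofunction {I : TopologicalSpace.Opens ℝ} (f : ComplexDistribution I) : Prop :=
  ∀ φ : 𝓓(I, ℂ), Continuous (localizedFourier f φ) ∧
    Filter.Tendsto (localizedFourier f φ) Filter.atTop (nhds 0) ∧
    Filter.Tendsto (localizedFourier f φ) Filter.atBot (nhds 0)

/-- `U(σ + it) → u(t)` in `𝓓'(I)` as `σ → 1⁺`. -/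
def HasBoundaryDistribution {I : TopologicalSpace.Opens ℝ} (U : ℂ → ℂ)
    (u : ComplexDistribution I) : Prop :=
  ∀ φ : 𝓓(I, ℂ), Filter.Tendsto
    (fun σ : ℝ => ∫ t : ℝ, U (σ + t * Complex.I) * φ t) (nhdsWithin 1 (Set.Ioi 1)) (nhds (u φ))

/-- `U` has local pseudofunction boundary behaviour on `1 + iI`: it has distributional boundary
values there, and its boundary distribution is a local pseudofunction on `I`. -/
def HasLocalPseudofunctionBoundary (I : TopologicalSpace.Opens ℝ) (U : ℂ → ℂ) : Prop :=
  ∃ u : ComplexDistribution I, HasBoundaryDistribution U u ∧ IsLocalPseudofunction u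

/-- `V` is a harmonic conjugate of `U` on `Ω`: the function `U + iV` is holomorphic on the
open set `Ω` (which forces `V` to be harmonic there). -/
def IsHarmonicConjugateOn (U V : ℂ → ℝ) (Ω : Set ℂ) : Prop :=
  DifferentiableOn ℂ (fun s => (U s : ℂ) + Complex.I * (V s : ℂ)) Ω

/-! Put `F = U + iV`. Paired with a test function `ψ`, the Cauchy–Riemann equation `∂_σ V = -∂_t U`
says that the slice of `V` has `σ`-derivative equal to the slice of `U` at `ψ'`. This stays bounded
as `σ → 1⁺`, so the slices of `V` converge, and Banach–Steinhaus makes the limit `v` a distribution.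
The rate is `O(σ - 1)`, with constant polynomial in `ξ` when `ψ` is `φ` modulated by `ξ`; hence the
localized transform of `v` is a locally uniform limit of continuous functions.

For decay, let `f = u + iv` be the boundary value of `F`. Multiplying `F` by the holomorphic factor
`e^{-l(s-1)}` turns `φ` into `φ e^{-ilt}` and adds the damping `e^{-l(σ-1)}`, so `σ`-derivatives
fall on `φ` alone and cost no power of `l`. Taylor expansion from `σ = 2` down to `σ = 1` then beats
the polynomial growth supplied by Banach–Steinhaus (`tendsto_modulate_of_hasDerivAt`). This gives
decay of the transform of `f` at `+∞`; the conjugate of `F`, with boundary value `u - iv`, handles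
`-∞`. Subtracting the pseudofunction `u` leaves `v` at either end. -/

/-! ### Banach–Steinhaus for distributions -/

open TopologicalSpace Filter Topology in
/-- The range of the embedding of `𝓓_{K}(E, F)` into the product of the spaces of bounded continuous
functions, given by all iterated derivatives, is closed. -/
theorem ContDiffMapSupportedIn.isClosedEmbedding_pi_structureMapCLM {E F : Type*}
    [NormedAddCommGroup E] [NormedSpace ℝ E] [NormedAddCommGroup F] [NormedSpace ℝ F]
    {K : Compacts E} :
    IsClosedEmbedding (ContinuousLinearMap.pi
      (ContDiffMapSupportedIn.structureMapCLM (E := E) (F := F) (K := K) ℝ ⊤)) := by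
  refine ⟨(isUniformEmbedding_pi_structureMapCLM ℝ).isEmbedding, ?_⟩
  rw [← closure_subset_iff_isClosed]
  intro g hg
  have (i : ℕ) : FirstCountableTopology (BoundedContinuousFunction E (E [×i]→L[ℝ] F)) :=
    inferInstance
  obtain ⟨x, hx, hlim⟩ := mem_closure_iff_seq_limit.1 hg
  choose f hf using hx
  rw [tendsto_pi_nhds] at hlim
  have hf' : ∀ n i, ⇑(x n i) = iteratedFDeriv ℝ i (f n) := by
    intro n i
    rw [← hf n, ContinuousLinearMap.pi_apply, structureMapCLM_top_apply]
  have hunif : ∀ i, TendstoUniformly (fun n => iteratedFDeriv ℝ i (f n)) (g i) atTop := by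
    intro i
    have := BoundedContinuousFunction.tendsto_iff_tendstoUniformly.1 (hlim i)
    simpa only [hf'] using this
  have hderiv : ∀ i y, HasFDerivAt (fun z => g i z) (g (i + 1) y).curryLeft y := by
    intro i y
    -- Currying is an isometry, so uniform convergence at order `i + 1` is uniform convergence of
    -- the derivatives at order `i`.
    have h1 : TendstoUniformlyOn (fun n z => fderiv ℝ (iteratedFDeriv ℝ i (f n)) z)
        (fun z => (g (i + 1) z).curryLeft) atTop Set.univ := by
      rw [tendstoUniformlyOn_univ]
      have hiso := (continuousMultilinearCurryLeftEquiv ℝ (fun _ : Fin (i + 1) => E)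
        F).isometry.uniformContinuous.comp_tendstoUniformly (hunif (i + 1))
      convert! hiso using 1
    refine hasFDerivAt_of_tendstoUniformlyOn (f := fun n => iteratedFDeriv ℝ i (f n)) isOpen_univ h1 (fun n z _ => ?_) (fun z _ => ?_)
      (Set.mem_univ y)
    · exact (((f n).contDiff.differentiable_iteratedFDeriv
        (by exact_mod_cast WithTop.coe_lt_top i)) z).hasFDerivAt
    · exact (hunif i).tendsto_at z
  have htaylor : HasFTaylorSeriesUpTo (⊤ : ℕ∞) (fun y => (g 0 y).curry0) (fun y i => g i y) :=
    ⟨fun y => rfl, fun i _ y => hderiv i y, fun i _ => (g i).continuous⟩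
  refine ⟨⟨fun y => (g 0 y).curry0, htaylor.contDiff, fun y hy => ?_⟩, ?_⟩
  · have h0 : Tendsto (fun n => iteratedFDeriv ℝ 0 (f n) y) atTop (𝓝 (g 0 y)) :=
      (hunif 0).tendsto_at y
    have h1 : ∀ n, iteratedFDeriv ℝ 0 (f n) y = 0 := fun n =>
      (f n).iteratedFDeriv_zero_on_compl hy
    simp only [h1] at h0
    have h2 : g 0 y = 0 := tendsto_nhds_unique h0 tendsto_const_nhds
    change (g 0 y).curry0 = 0
    rw [h2]
    rfl
  · ext i y : 2
    rw [ContinuousLinearMap.pi_apply, structureMapCLM_top_apply]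
    exact (htaylor.eq_iteratedFDeriv (by exact_mod_cast le_top) y).symm

-- A closed subspace of a countable product of Banach spaces is completely metrizable, so Baire's
-- theorem applies.
open TopologicalSpace in
theorem ContDiffMapSupportedIn.baireSpace {E F : Type*}
    [NormedAddCommGroup E] [NormedSpace ℝ E] [NormedAddCommGroup F] [NormedSpace ℝ F]
    [CompleteSpace F] {K : Compacts E} : BaireSpace 𝓓_{K}(E, F) :=
  have (i : ℕ) : IsCompletelyMetrizableSpace (BoundedContinuousFunction E (E [×i]→L[ℝ] F)) :=
    by
    have : CompleteSpace (BoundedContinuousFunction E (E [×i]→L[ℝ] F)) := inferInstance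
    exact ⟨BoundedContinuousFunction.instMetricSpace, rfl, this⟩
  have := (isClosedEmbedding_pi_structureMapCLM (E := E) (F := F)
    (K := K)).IsCompletelyMetrizableSpace
  inferInstance

open TopologicalSpace in
/-- **Banach–Steinhaus** for distributions: a pointwise bounded family of distributions has,
on every compact set, uniformly bounded order. -/
theorem ComplexDistribution.exists_bound_of_pointwise_bounded {I : Opens ℝ} {ι : Type*}
    (T : ι → ComplexDistribution I) (hT : ∀ ψ, ∃ C, ∀ i, ‖T i ψ‖ ≤ C)
    {K : Compacts ℝ} (hK : (K : Set ℝ) ⊆ I) :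
    ∃ (M : ℕ) (C : ℝ), 0 ≤ C ∧ ∀ i (ψ : 𝓓_{K}(ℝ, ℂ)), ‖T i (TestFunction.ofSupportedIn hK ψ)‖ ≤
      C * ContDiffMapSupportedIn.supSeminorm ℂ ℝ ℂ ⊤ K M ψ := by
  have := ContDiffMapSupportedIn.baireSpace (E := ℝ) (F := ℂ) (K := K)
  let p : ι → Seminorm ℂ 𝓓_{K}(ℝ, ℂ) := fun i =>
    (normSeminorm ℂ ℂ).comp ((T i).comp (TestFunction.ofSupportedInCLM ℂ hK)).toLinearMap
  have hpv : ∀ i ψ, p i ψ = ‖T i (TestFunction.ofSupportedIn hK ψ)‖ := fun _ _ => rfl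
  have hbdd : BddAbove (Set.range p) := by
    rw [Seminorm.bddAbove_range_iff]
    intro ψ
    obtain ⟨C, hC⟩ := hT (TestFunction.ofSupportedIn hK ψ)
    exact ⟨C, by rintro _ ⟨i, rfl⟩; exact hC i⟩
  have hcont : Continuous (⨆ i, p i) := Seminorm.continuous_iSup _
    (fun i => continuous_norm.comp
      ((T i).comp (TestFunction.ofSupportedInCLM ℂ hK)).continuous) hbdd
  rw [← Seminorm.coe_iSup_eq hbdd] at hcont
  obtain ⟨s, C, -, hC⟩ := Seminorm.bound_of_continuous
    (ContDiffMapSupportedIn.withSeminorms' ℂ ℝ ℂ ⊤ K) (⨆ i, p i) hcont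
  -- The seminorms increase with the order, so the largest order in the finite set `s` dominates.
  refine ⟨s.sup id, C, C.2, fun i ψ => ?_⟩
  rw [← hpv]
  have h1 : p i ψ ≤ (⨆ i, p i) ψ := by
    rw [Seminorm.iSup_apply hbdd]
    exact le_ciSup ((Seminorm.bddAbove_range_iff).1 hbdd ψ) i
  refine h1.trans ((hC ψ).trans ?_)
  change (C : ℝ) * _ ≤ _
  gcongr
  have hle : s.sup (ContDiffMapSupportedIn.supSeminorm ℂ ℝ ℂ ⊤ K) ≤
      ContDiffMapSupportedIn.supSeminorm ℂ ℝ ℂ ⊤ K (s.sup id) :=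
    Finset.sup_le fun j hj => Finset.sup_mono (Finset.Iic_subset_Iic.2 (Finset.le_sup (f := id) hj))
  exact hle ψ

/-! ### Differentiation and modulation of test functions -/

theorem modulate_apply {I : TopologicalSpace.Opens ℝ} (φ : 𝓓(I, ℂ)) (ξ t : ℝ) :
    modulate φ ξ t = φ t * Complex.exp (-(Complex.I * ξ * t)) := rfl

/-- The derivative of a test function of one real variable. -/
noncomputable def testDeriv {I : TopologicalSpace.Opens ℝ} : 𝓓(I, ℂ) →L[ℂ] 𝓓(I, ℂ) :=
  TestFunction.lineDerivCLM ℂ (1 : ℝ)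

theorem TestFunction.hasDerivAt {I : TopologicalSpace.Opens ℝ} (φ : 𝓓(I, ℂ)) (t : ℝ) :
    HasDerivAt φ (deriv φ t) t :=
  ((φ.contDiff.differentiable (by simp)) t).hasDerivAt

theorem testDeriv_apply {I : TopologicalSpace.Opens ℝ} (φ : 𝓓(I, ℂ)) (t : ℝ) :
    testDeriv φ t = deriv φ t := by
  have h : lineDeriv ℝ φ t (1 : ℝ) = deriv φ t := by
    simpa using (φ.hasDerivAt t).hasFDerivAt.hasLineDerivAt (1 : ℝ) |>.lineDeriv
  rw [testDeriv, TestFunction.lineDerivCLM_apply, if_pos (by simp), h]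

theorem tsupport_testDeriv_subset {I : TopologicalSpace.Opens ℝ} (φ : 𝓓(I, ℂ)) :
    tsupport (testDeriv φ) ⊆ tsupport φ := by
  have h : ⇑(testDeriv φ) = deriv φ := funext (testDeriv_apply φ)
  rw [h]
  exact closure_minimal (support_deriv_subset (f := φ)) (isClosed_tsupport φ)

theorem tsupport_modulate_subset {I : TopologicalSpace.Opens ℝ} (φ : 𝓓(I, ℂ)) (ξ : ℝ) :
    tsupport (modulate φ ξ) ⊆ tsupport φ :=
  tsupport_mul_subset_left

theorem hasDerivAt_cexp_neg_I_mul (ξ t : ℝ) :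
    HasDerivAt (fun t : ℝ => Complex.exp (-(Complex.I * ξ * t)))
      (-(Complex.I * ξ) * Complex.exp (-(Complex.I * ξ * t))) t := by
  have h := ((Complex.ofRealCLM.hasDerivAt (x := t)).const_mul (Complex.I * ξ)).neg.cexp
  convert! h using 1
  simp [mul_comm]

theorem norm_cexp_neg_I_mul (ξ t : ℝ) : ‖Complex.exp (-(Complex.I * ξ * t))‖ = 1 := by
  rw [Complex.norm_exp]
  simp

theorem testDeriv_modulate {I : TopologicalSpace.Opens ℝ} (φ : 𝓓(I, ℂ)) (ξ : ℝ) :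
    testDeriv (modulate φ ξ) = modulate (testDeriv φ) ξ - (Complex.I * ξ) • modulate φ ξ := by
  ext t
  rw [testDeriv_apply]
  have h := ((φ.hasDerivAt t).mul (hasDerivAt_cexp_neg_I_mul ξ t)).deriv
  change deriv (modulate φ ξ) t = _ at h
  rw [h, FunLike.coe_sub, FunLike.coe_smul]
  simp only [Pi.sub_apply, Pi.smul_apply, modulate_apply, testDeriv_apply, smul_eq_mul]
  ring

theorem norm_iteratedFDeriv_cexp_neg_I_mul (n : ℕ) (ξ t : ℝ) :
    ‖iteratedFDeriv ℝ n (fun t : ℝ => Complex.exp (-(Complex.I * ξ * t))) t‖ = |ξ| ^ n := by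
  have h : ∀ n : ℕ, iteratedDeriv n (fun t : ℝ => Complex.exp (-(Complex.I * ξ * t))) =
      fun t : ℝ => (-(Complex.I * ξ)) ^ n * Complex.exp (-(Complex.I * ξ * t)) := by
    intro n
    induction n with
    | zero => simp
    | succ n ih =>
      rw [iteratedDeriv_succ, ih]
      funext t
      rw [((hasDerivAt_cexp_neg_I_mul ξ t).const_mul _).deriv]
      ring
  rw [norm_iteratedFDeriv_eq_norm_iteratedDeriv, h]
  simp [norm_cexp_neg_I_mul]

open TopologicalSpace in
/-- A test function on `I` with support in `K`, as an element of `𝓓_{K}`. -/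
noncomputable def TestFunction.toSupportedIn {I : Opens ℝ} {K : Compacts ℝ} (φ : 𝓓(I, ℂ))
    (h : tsupport φ ⊆ K) : 𝓓_{K}(ℝ, ℂ) :=
  .of_support_subset φ.contDiff ((subset_tsupport φ).trans h)

open TopologicalSpace in
/-- Modulation by `ξ` increases the seminorm of order `M` at most by a factor `(1 + |ξ|) ^ M`. -/
theorem supSeminorm_modulate_le {I : Opens ℝ} {K : Compacts ℝ} (φ : 𝓓(I, ℂ))
    (h : tsupport φ ⊆ K) (ξ : ℝ) (M : ℕ) :
    ContDiffMapSupportedIn.supSeminorm ℂ ℝ ℂ ⊤ K M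
        ((modulate φ ξ).toSupportedIn ((tsupport_modulate_subset φ ξ).trans h)) ≤
      ContDiffMapSupportedIn.supSeminorm ℂ ℝ ℂ ⊤ K M (φ.toSupportedIn h) * (1 + |ξ|) ^ M := by
  set A := ContDiffMapSupportedIn.supSeminorm ℂ ℝ ℂ ⊤ K M (φ.toSupportedIn h) with hA
  have hA0 : 0 ≤ A := apply_nonneg _ _
  refine Seminorm.finset_sup_apply_le (by positivity) fun i hi => ?_
  rw [Finset.mem_Iic] at hi
  rw [ContDiffMapSupportedIn.seminorm_top_le_iff ℂ (by positivity)]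
  intro t _
  have hj : ∀ j ≤ i, ‖iteratedFDeriv ℝ j φ t‖ ≤ A := fun j hj =>
    (ContDiffMapSupportedIn.norm_iteratedFDeriv_apply_le_seminorm_top ℂ
      (f := φ.toSupportedIn h)).trans
      (Seminorm.le_finset_sup_apply (Finset.mem_Iic.2 (hj.trans hi)))
  calc ‖iteratedFDeriv ℝ i (fun t : ℝ => φ t * Complex.exp (-(Complex.I * ξ * t))) t‖
      ≤ ∑ j ∈ Finset.range (i + 1), (i.choose j : ℝ) * ‖iteratedFDeriv ℝ j φ t‖ *
          ‖iteratedFDeriv ℝ (i - j) (fun t : ℝ => Complex.exp (-(Complex.I * ξ * t))) t‖ :=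
        norm_iteratedFDeriv_mul_le φ.contDiff
          ((contDiff_const.mul Complex.ofRealCLM.contDiff).neg.cexp) t (by exact_mod_cast le_top)
    _ ≤ ∑ j ∈ Finset.range (i + 1), (i.choose j : ℝ) * A * |ξ| ^ (i - j) := by
        gcongr with j hj'
        · exact hj j (Finset.mem_range_succ_iff.1 hj')
        · exact (norm_iteratedFDeriv_cexp_neg_I_mul _ _ _).le
    _ = A * (1 + |ξ|) ^ i := by
        rw [add_pow, Finset.mul_sum]
        refine Finset.sum_congr rfl fun j _ => ?_
        ring
    _ ≤ A * (1 + |ξ|) ^ M := by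
        gcongr
        linarith [abs_nonneg ξ]

open TopologicalSpace in
/-- The Fourier transforms of a pointwise bounded family of distributions, localized by test
functions with support in a fixed compact set, have uniformly polynomial growth. -/
theorem ComplexDistribution.exists_bound_modulate {I : Opens ℝ} {ι : Type*}
    (T : ι → ComplexDistribution I) (hT : ∀ ψ, ∃ C, ∀ i, ‖T i ψ‖ ≤ C)
    {K : Compacts ℝ} (hK : (K : Set ℝ) ⊆ I) :
    ∃ M : ℕ, ∀ φ : 𝓓(I, ℂ), tsupport φ ⊆ K →
      ∃ C, 0 ≤ C ∧ ∀ i ξ, ‖T i (modulate φ ξ)‖ ≤ C * (1 + |ξ|) ^ M := by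
  obtain ⟨M, C, hC, h⟩ := ComplexDistribution.exists_bound_of_pointwise_bounded T hT hK
  refine ⟨M, fun φ hφ => ⟨C * ContDiffMapSupportedIn.supSeminorm ℂ ℝ ℂ ⊤ K M
    (φ.toSupportedIn hφ), mul_nonneg hC (apply_nonneg _ _), fun i ξ => ?_⟩⟩
  refine (h i ((modulate φ ξ).toSupportedIn ((tsupport_modulate_subset φ ξ).trans hφ))).trans ?_
  rw [mul_assoc]
  exact mul_le_mul_of_nonneg_left (supSeminorm_modulate_le φ hφ ξ M) hC

/-! ### One-sided decay of Fourier transforms of boundary values -/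

open MeasureTheory Filter Topology

/-- A continuous function on `(1, ∞)` with a limit at `1` is bounded on `(1, 2]`. -/
theorem exists_norm_le_Ioc_of_tendsto {g : ℝ → ℂ} {a : ℂ} (hg : ContinuousOn g (Set.Ioi 1))
    (ha : Tendsto g (𝓝[>] 1) (𝓝 a)) : ∃ C, ∀ σ ∈ Set.Ioc (1 : ℝ) 2, ‖g σ‖ ≤ C := by
  have h1 : ∀ᶠ σ in 𝓝[>] (1 : ℝ), ‖g σ‖ < ‖a‖ + 1 :=
    ha.norm.eventually_lt_const (by linarith)
  obtain ⟨b, hb, hb'⟩ := mem_nhdsGT_iff_exists_Ioc_subset.1 h1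
  obtain ⟨C, hC⟩ := (isCompact_Icc (a := b) (b := (2 : ℝ))).exists_bound_of_continuousOn
    (hg.mono fun x hx => lt_of_lt_of_le hb hx.1)
  refine ⟨max (‖a‖ + 1) C, fun σ hσ => ?_⟩
  rcases le_total σ b with h | h
  · exact (le_of_lt (hb' ⟨hσ.1, h⟩)).trans (le_max_left _ _)
  · exact (hC σ ⟨h, hσ.2⟩).trans (le_max_right _ _)

/-- The sum is the Taylor polynomial of `s 0` with moving base point `σ`, evaluated at `1`; its
derivative telescopes to the last term. -/
theorem hasDerivAt_taylor_sum {s : ℕ → ℝ → ℂ} {c : ℂ} {σ : ℝ}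
    (hs : ∀ k, HasDerivAt (s k) (c * s (k + 1) σ) σ) (N : ℕ) :
    HasDerivAt (fun σ => ∑ k ∈ Finset.range (N + 1),
        (-c) ^ k * ((σ - 1 : ℝ) ^ k / k.factorial : ℂ) * s k σ)
      (c * (-c) ^ N * ((σ - 1 : ℝ) ^ N / N.factorial : ℂ) * s (N + 1) σ) σ := by
  induction N with
  | zero => simpa using hs 0
  | succ N ih =>
    have hlin : HasDerivAt (fun σ : ℝ => ((σ - 1 : ℝ) : ℂ)) 1 σ := by
      simpa using ((hasDerivAt_id σ).sub_const 1).ofReal_comp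
    have hpow : HasDerivAt (fun σ : ℝ => ((σ - 1 : ℝ) : ℂ) ^ (N + 1) / ((N + 1).factorial : ℂ))
        (((σ - 1 : ℝ) : ℂ) ^ N / (N.factorial : ℂ)) σ := by
      refine ((hlin.pow (N + 1)).div_const _).congr_deriv ?_
      rw [Nat.factorial_succ]
      have : (N.factorial : ℂ) ≠ 0 := by exact_mod_cast N.factorial_ne_zero
      have h2 : ((N : ℂ) + 1) ≠ 0 := by exact_mod_cast N.succ_ne_zero
      push_cast
      simp only [mul_one]
      field_simp
    have := ih.add ((hpow.const_mul ((-c) ^ (N + 1))).mul (hs (N + 1)))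
    simp only [Finset.sum_range_succ _ (N + 1)]
    refine this.congr_deriv ?_
    ring

/-- A Taylor estimate at the left endpoint `1` of `(1, 2]`, based on the expansion at `2`. -/
theorem norm_limit_le_taylor {s : ℕ → ℝ → ℂ} {a : ℕ → ℂ} {c : ℂ} (hc : ‖c‖ = 1) {B : ℝ} {N : ℕ}
    (hs : ∀ k, ∀ σ > 1, HasDerivAt (s k) (c * s (k + 1) σ) σ)
    (ha : ∀ k, Tendsto (s k) (𝓝[>] 1) (𝓝 (a k)))
    (hB : ∀ σ ∈ Set.Ioc (1 : ℝ) 2, (σ - 1) ^ N / N.factorial * ‖s (N + 1) σ‖ ≤ B) :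
    ‖a 0‖ ≤ B + ∑ k ∈ Finset.range (N + 1), ‖s k 2‖ := by
  set G : ℝ → ℂ := fun σ => ∑ k ∈ Finset.range (N + 1),
        (-c) ^ k * ((σ - 1 : ℝ) ^ k / k.factorial : ℂ) * s k σ with hG
  have hB0 : 0 ≤ B := le_trans (by positivity) (hB 2 (by norm_num))
  -- Every term with `k ≥ 1` carries a factor `σ - 1` and disappears in the limit.
  have hlim : Tendsto G (𝓝[>] 1) (𝓝 (a 0)) := by
    have h : ∀ k, Tendsto (fun σ : ℝ => (-c) ^ k * ((σ - 1 : ℝ) ^ k / k.factorial : ℂ) * s k σ)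
        (𝓝[>] 1) (𝓝 ((-c) ^ k * (((1 - 1 : ℝ) : ℂ) ^ k / k.factorial : ℂ) * a k)) := by
      intro k
      refine Tendsto.mul (Tendsto.mono_left ?_ nhdsWithin_le_nhds) (ha k)
      exact Continuous.tendsto (f := fun σ : ℝ =>
        (-c) ^ k * ((σ - 1 : ℝ) ^ k / k.factorial : ℂ)) (by fun_prop) 1
    have h2 := tendsto_finsetSum (Finset.range (N + 1)) fun k _ => h k
    rw [Finset.sum_range_succ'] at h2
    simpa [hG] using h2
  have hdiff : ∀ σ ∈ Set.Ioc (1 : ℝ) 2, ‖G σ‖ ≤ B + ‖G 2‖ := by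
    intro σ hσ
    have h1 : ‖G 2 - G σ‖ ≤ B * (2 - σ) := by
      refine norm_image_sub_le_of_norm_deriv_le_segment' (f' := fun σ => c * (-c) ^ N *
        ((σ - 1 : ℝ) ^ N / N.factorial : ℂ) * s (N + 1) σ) (fun x hx => ?_) (fun x hx => ?_) 2
        ⟨hσ.2, le_rfl⟩
      · exact (hasDerivAt_taylor_sum (fun k => hs k x (hσ.1.trans_le hx.1)) N).hasDerivWithinAt
      · have hx1 : 1 < x := hσ.1.trans_le hx.1
        refine le_trans (le_of_eq ?_) (hB x ⟨hx1, hx.2.le⟩)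
        simp only [norm_mul, norm_pow, norm_neg, hc, norm_div, Complex.norm_real, one_pow, one_mul,
          Complex.norm_natCast, Real.norm_eq_abs, abs_of_pos (sub_pos.2 hx1)]
    have h2 : ‖G σ‖ ≤ ‖G 2‖ + ‖G 2 - G σ‖ := by
      have := norm_sub_le (G 2) (G 2 - G σ)
      simpa using this
    nlinarith [hσ.1, hσ.2]
  have hfin : ‖a 0‖ ≤ B + ‖G 2‖ := by
    refine le_of_tendsto hlim.norm ?_
    filter_upwards [Ioc_mem_nhdsGT (show (1 : ℝ) < 2 by norm_num)] with σ hσ using hdiff σ hσ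
  refine hfin.trans (add_le_add_right (norm_sum_le_of_le _ fun k _ => ?_) B)
  have hk : (1 : ℝ) ≤ k.factorial := by exact_mod_cast Nat.one_le_of_lt k.factorial_pos
  simp only [norm_mul, norm_pow, norm_neg, hc, norm_div, Complex.norm_real, one_pow, one_mul,
    Complex.norm_natCast, Real.norm_eq_abs]
  norm_num
  exact mul_le_of_le_one_left (norm_nonneg _) (inv_le_one_of_one_le₀ hk)

theorem ComplexDistribution.exists_bound_Ioc {I : TopologicalSpace.Opens ℝ}
    {T : ℝ → ComplexDistribution I} {f : 𝓓(I, ℂ) → ℂ}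
    (hT : ∀ ψ, ContinuousOn (fun σ => T σ ψ) (Set.Ioi 1))
    (hf : ∀ ψ, Tendsto (fun σ => T σ ψ) (𝓝[>] 1) (𝓝 (f ψ)))
    (ψ : 𝓓(I, ℂ)) : ∃ C, ∀ i : Set.Ioc (1 : ℝ) 2, ‖T i ψ‖ ≤ C :=
  (exists_norm_le_Ioc_of_tendsto (hT ψ) (hf ψ)).imp fun _ h i => h i i.2

/-- The term `-l` from the exponential cancels against `ε i · (-iεl) = l` from the modulation,
leaving only the derivative of `ψ`. -/
theorem hasDerivAt_exp_mul_modulate {I : TopologicalSpace.Opens ℝ} {T : ℝ → ComplexDistribution I}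
    {ε : ℝ} (hε : ε ^ 2 = 1) {σ : ℝ} (hT : ∀ ψ, HasDerivAt (fun σ => T σ ψ)
      (ε * Complex.I * T σ (testDeriv ψ)) σ) (l : ℝ) (ψ : 𝓓(I, ℂ)) :
    HasDerivAt (fun σ : ℝ => (Real.exp (-(l * (σ - 1))) : ℂ) * T σ (modulate ψ (ε * l)))
      (ε * Complex.I * ((Real.exp (-(l * (σ - 1))) : ℂ) *
        T σ (modulate (testDeriv ψ) (ε * l)))) σ := by
  have h1 : HasDerivAt (fun σ : ℝ => Real.exp (-(l * (σ - 1))))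
      (Real.exp (-(l * (σ - 1))) * -(l * 1)) σ :=
    (((hasDerivAt_id σ).sub_const 1).const_mul l).neg.exp
  refine (h1.ofReal_comp.mul (hT (modulate ψ (ε * l)))).congr_deriv ?_
  rw [testDeriv_modulate, map_sub, map_smul]
  have hε' : (ε : ℂ) ^ 2 = 1 := by exact_mod_cast hε
  push_cast
  simp only [smul_eq_mul]
  linear_combination (-(Complex.exp (-(l * (σ - 1))) * l * T σ (modulate ψ (ε * l)) *
    (ε : ℂ) ^ 2)) * Complex.I_sq + (Complex.exp (-(l * (σ - 1))) * l *
    T σ (modulate ψ (ε * l))) * hε'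

/-- If `∂_σ T_σ = ± i ∂_t T_σ` for `σ > 1`, as for (anti)holomorphic functions of `σ + it`, then the
Fourier transforms of the localizations of the boundary value at `σ = 1` decay at `± ∞`. -/
theorem tendsto_modulate_of_hasDerivAt {I : TopologicalSpace.Opens ℝ}
    {T : ℝ → ComplexDistribution I} {ε : ℝ} (hε : ε ^ 2 = 1)
    (hT : ∀ σ > 1, ∀ ψ, HasDerivAt (fun σ => T σ ψ) (ε * Complex.I * T σ (testDeriv ψ)) σ)
    {f : 𝓓(I, ℂ) → ℂ} (hf : ∀ ψ, Tendsto (fun σ => T σ ψ) (𝓝[>] 1) (𝓝 (f ψ)))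
    (φ : 𝓓(I, ℂ)) : Tendsto (fun l : ℝ => f (modulate φ (ε * l))) atTop (𝓝 0) := by
  have hε1 : |ε| = 1 := by
    rwa [← sq_abs, pow_eq_one_iff_of_nonneg (abs_nonneg _) two_ne_zero] at hε
  -- The order `M` depends only on the support of `φ`, so it serves all derivatives of `φ` and may
  -- fix the length of the Taylor expansion.
  obtain ⟨M, hM⟩ := ComplexDistribution.exists_bound_modulate
    (fun i : Set.Ioc (1 : ℝ) 2 => T i)
    (ComplexDistribution.exists_bound_Ioc
      (fun ψ σ hσ => (hT σ hσ ψ).continuousAt.continuousWithinAt) hf)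
    (K := ⟨tsupport φ, φ.hasCompactSupport⟩) φ.tsupport_subset
  have hsupp : ∀ k, tsupport (testDeriv^[k] φ) ⊆ tsupport φ := by
    intro k
    induction k with
    | zero => exact subset_rfl
    | succ k ih =>
      rw [Function.iterate_succ_apply']
      exact (tsupport_testDeriv_subset _).trans ih
  choose C hC0 hC using fun k => hM (testDeriv^[k] φ) (hsupp k)
  have key : ∀ l : ℝ, 1 ≤ l → ‖f (modulate φ (ε * l))‖ ≤ C (M + 2) * 2 ^ M * l⁻¹ +
      (∑ k ∈ Finset.range (M + 2), C k) * 2 ^ M * (l ^ M * Real.exp (-l)) := by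
    intro l hl
    have hl0 : 0 < l := by linarith
    have habs : |ε * l| = l := by rw [abs_mul, hε1, one_mul, abs_of_pos hl0]
    have hpow : (1 + l) ^ M ≤ 2 ^ M * l ^ M := by
      rw [← mul_pow]
      gcongr
      linarith
    have hbd : ∀ k, ∀ σ ∈ Set.Ioc (1 : ℝ) 2,
        ‖(Real.exp (-(l * (σ - 1))) : ℂ) * T σ (modulate (testDeriv^[k] φ) (ε * l))‖ ≤
          Real.exp (-(l * (σ - 1))) * (C k * (2 ^ M * l ^ M)) := by
      intro k σ hσ
      rw [norm_mul, Complex.norm_real, Real.norm_eq_abs, Real.abs_exp]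
      gcongr
      refine (hC k ⟨σ, hσ⟩ (ε * l)).trans ?_
      rw [habs]
      exact mul_le_mul_of_nonneg_left hpow (hC0 k)
    -- With `N = M + 1`, the bound `x^N / N! ≤ e^x` at `x = l(σ - 1)` gains `l^{-(M+1)}` against the
    -- growth `l^M`. The terms at `σ = 2` carry `e^{-l}`.
    have hmain := norm_limit_le_taylor
      (s := fun k σ => (Real.exp (-(l * (σ - 1))) : ℂ) *
        T σ (modulate (testDeriv^[k] φ) (ε * l)))
      (a := fun k => f (modulate (testDeriv^[k] φ) (ε * l)))
      (c := ε * Complex.I) (B := C (M + 2) * 2 ^ M * l⁻¹) (N := M + 1) (by simp [hε1])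
      (fun k σ hσ => by
        rw [Function.iterate_succ_apply']
        exact hasDerivAt_exp_mul_modulate hε (hT σ hσ) l _)
      (fun k => by
        have h1 : Tendsto (fun σ : ℝ => (Real.exp (-(l * (σ - 1))) : ℂ)) (𝓝[>] 1) (𝓝 1) := by
          have : Continuous fun σ : ℝ => (Real.exp (-(l * (σ - 1))) : ℂ) := by fun_prop
          simpa using (this.tendsto 1).mono_left nhdsWithin_le_nhds
        simpa using h1.mul (hf (modulate (testDeriv^[k] φ) (ε * l))))
      (fun σ hσ => by
        have hσ0 : 0 ≤ σ - 1 := by linarith [hσ.1]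
        have hexp : (l * (σ - 1)) ^ (M + 1) / (M + 1).factorial * Real.exp (-(l * (σ - 1))) ≤ 1 := by
          rw [Real.exp_neg, ← div_eq_mul_inv, div_le_one (Real.exp_pos _)]
          exact Real.pow_div_factorial_le_exp _ (by positivity) _
        calc (σ - 1) ^ (M + 1) / (M + 1).factorial *
              ‖(Real.exp (-(l * (σ - 1))) : ℂ) * T σ (modulate (testDeriv^[M + 1 + 1] φ) (ε * l))‖
            ≤ (σ - 1) ^ (M + 1) / (M + 1).factorial *
              (Real.exp (-(l * (σ - 1))) * (C (M + 2) * (2 ^ M * l ^ M))) := by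
              gcongr
              exact hbd (M + 2) σ hσ
          _ = ((l * (σ - 1)) ^ (M + 1) / (M + 1).factorial * Real.exp (-(l * (σ - 1)))) *
              (C (M + 2) * 2 ^ M * l⁻¹) := by
              rw [mul_pow, pow_succ l M]
              field_simp
          _ ≤ 1 * (C (M + 2) * 2 ^ M * l⁻¹) := by
              have := hC0 (M + 2)
              gcongr
          _ = _ := one_mul _)
    refine hmain.trans (add_le_add_right ?_ _)
    rw [Finset.sum_mul, Finset.sum_mul]
    refine Finset.sum_le_sum fun k _ => ?_
    have := hbd k 2 (by norm_num)
    refine this.trans (le_of_eq ?_)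
    norm_num
    ring
  refine squeeze_zero_norm' (eventually_atTop.2 ⟨1, key⟩) ?_
  have h1 := (tendsto_inv_atTop_zero (𝕜 := ℝ)).const_mul (C (M + 2) * 2 ^ M)
  have h2 := (Real.tendsto_pow_mul_exp_neg_atTop_nhds_zero M).const_mul
    ((∑ k ∈ Finset.range (M + 2), C k) * 2 ^ M)
  simpa using h1.add h2

/-! ### Vertical slices and the Cauchy–Riemann equations -/

theorem isOpen_halfPlane : IsOpen halfPlane := isOpen_lt continuous_const Complex.continuous_re

theorem mem_halfPlane_of_one_lt {σ : ℝ} (hσ : 1 < σ) (t : ℝ) :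
    (σ + t * Complex.I : ℂ) ∈ halfPlane := by
  simpa [halfPlane] using hσ

theorem ContinuousOn.continuous_slice {H : ℂ → ℂ} (hH : ContinuousOn H halfPlane) {σ : ℝ}
    (hσ : 1 < σ) : Continuous fun t : ℝ => H (σ + t * Complex.I) :=
  hH.comp_continuous (by fun_prop) fun t => mem_halfPlane_of_one_lt hσ t

theorem TestFunction.integrable_mul {I : TopologicalSpace.Opens ℝ} {g : ℝ → ℂ} (hg : Continuous g)
    (ψ : 𝓓(I, ℂ)) : Integrable fun t => g t * ψ t :=
  (hg.mul ψ.continuous).integrable_of_hasCompactSupport ψ.hasCompactSupport.mul_left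

/-- The distribution `ψ ↦ ∫ H(σ + it) ψ(t) dt`. -/
noncomputable def verticalSlice (I : TopologicalSpace.Opens ℝ) (H : ℂ → ℂ) (σ : ℝ) :
    ComplexDistribution I :=
  TestFunction.integralAgainstBilinCLM (ContinuousLinearMap.mul ℂ ℂ) volume
    fun t : ℝ => H (σ + t * Complex.I)

theorem verticalSlice_apply {I : TopologicalSpace.Opens ℝ} {H : ℂ → ℂ}
    (hH : ContinuousOn H halfPlane) {σ : ℝ} (hσ : 1 < σ) (ψ : 𝓓(I, ℂ)) :
    verticalSlice I H σ ψ = ∫ t : ℝ, H (σ + t * Complex.I) * ψ t := by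
  rw [verticalSlice, TestFunction.integralAgainstBilinCLM_eq_integral
    ((hH.continuous_slice hσ).locallyIntegrable.locallyIntegrableOn _)]
  simp [mul_comm]

/-- Continuity of the Fourier transform of a localized continuous function. -/
theorem continuous_verticalSlice_modulate {I : TopologicalSpace.Opens ℝ} {H : ℂ → ℂ}
    (hH : ContinuousOn H halfPlane) {σ : ℝ} (hσ : 1 < σ) (φ : 𝓓(I, ℂ)) :
    Continuous fun ξ => verticalSlice I H σ (modulate φ ξ) := by
  simp only [verticalSlice_apply hH hσ, modulate_apply, ← mul_assoc]
  refine continuous_of_dominated (bound := fun t => ‖H (σ + t * Complex.I) * φ t‖)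
    (fun ξ => ?_) (fun ξ => ?_) (TestFunction.integrable_mul (hH.continuous_slice hσ) φ).norm ?_
  · have := hH.continuous_slice hσ
    exact ((this.mul φ.continuous).mul (by fun_prop)).aestronglyMeasurable
  · refine Eventually.of_forall fun t => ?_
    rw [norm_mul, norm_cexp_neg_I_mul, mul_one]
  · exact Eventually.of_forall fun t => by fun_prop

/-- The Cauchy–Riemann equations, integrated against a test function. -/
theorem hasDerivAt_verticalSlice {I : TopologicalSpace.Opens ℝ} {H D : ℂ → ℂ} {κ : ℂ}
    (hκ : κ * κ = -1) (hH : ContinuousOn H halfPlane) (hD : ContinuousOn D halfPlane)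
    (h1 : ∀ σ : ℝ, 1 < σ → ∀ t : ℝ,
      HasDerivAt (fun σ : ℝ => H (σ + t * Complex.I)) (D (σ + t * Complex.I)) σ)
    (h2 : ∀ σ : ℝ, 1 < σ → ∀ t : ℝ,
      HasDerivAt (fun t : ℝ => H (σ + t * Complex.I)) (κ * D (σ + t * Complex.I)) t)
    {σ : ℝ} (hσ : 1 < σ) (ψ : 𝓓(I, ℂ)) :
    HasDerivAt (fun σ => verticalSlice I H σ ψ) (κ * verticalSlice I H σ (testDeriv ψ)) σ := by
  have hparts : ∫ t : ℝ, H (σ + t * Complex.I) * testDeriv ψ t =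
      -∫ t : ℝ, κ * D (σ + t * Complex.I) * ψ t := by
    refine integral_mul_deriv_eq_deriv_mul_of_integrable (fun t _ => h2 σ hσ t)
      (fun t _ => by rw [testDeriv_apply]; exact ψ.hasDerivAt t)
      (TestFunction.integrable_mul (hH.continuous_slice hσ) _)
      (TestFunction.integrable_mul (continuous_const.mul (hD.continuous_slice hσ)) ψ)
      (TestFunction.integrable_mul (hH.continuous_slice hσ) ψ)
  have hval : κ * verticalSlice I H σ (testDeriv ψ) = ∫ t : ℝ, D (σ + t * Complex.I) * ψ t := by
    rw [verticalSlice_apply hH hσ, hparts]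
    simp only [mul_assoc, integral_const_mul]
    linear_combination (-∫ t : ℝ, D (σ + t * Complex.I) * ψ t) * hκ
  rw [hval]
  -- A compact neighbourhood of `σ` inside `(1, ∞)`, so that `D` is bounded on its product with the
  -- support of `ψ`.
  have hs : Set.Icc ((1 + σ) / 2) (σ + 1) ∈ 𝓝 σ := Icc_mem_nhds (by linarith) (by linarith)
  have hs1 : ∀ x ∈ Set.Icc ((1 + σ) / 2) (σ + 1), 1 < x := fun x hx => by linarith [hx.1]
  obtain ⟨C, hC⟩ := ((isCompact_Icc (a := (1 + σ) / 2) (b := σ + 1)).prod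
    ψ.hasCompactSupport.isCompact).exists_bound_of_continuousOn
    (f := fun p : ℝ × ℝ => D (p.1 + p.2 * Complex.I))
    (hD.comp (by fun_prop) fun p hp => mem_halfPlane_of_one_lt (hs1 _ hp.1) _)
  have hder := (hasDerivAt_integral_of_dominated_loc_of_deriv_le (μ := volume) (x₀ := σ)
    (F := fun (x : ℝ) (t : ℝ) => H (x + t * Complex.I) * ψ t)
    (F' := fun (x : ℝ) (t : ℝ) => D (x + t * Complex.I) * ψ t) (bound := fun t => C * ‖ψ t‖) hs
    (by
      filter_upwards [hs] with x hx
      exact (TestFunction.integrable_mul (hH.continuous_slice (hs1 x hx)) ψ).aestronglyMeasurable)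
    (TestFunction.integrable_mul (hH.continuous_slice hσ) ψ)
    (TestFunction.integrable_mul (hD.continuous_slice hσ) ψ).aestronglyMeasurable
    (Eventually.of_forall fun t x hx => by
      rw [norm_mul]
      by_cases ht : t ∈ tsupport ψ
      · exact mul_le_mul_of_nonneg_right (hC (x, t) ⟨hx, ht⟩) (norm_nonneg _)
      · simp [image_eq_zero_of_notMem_tsupport ht])
    ((ψ.continuous.integrable_of_hasCompactSupport ψ.hasCompactSupport).norm.const_mul C)
    (Eventually.of_forall fun t x hx => (h1 x (hs1 x hx) t).mul_const (ψ t))).2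
  refine hder.congr_of_eventuallyEq ?_
  filter_upwards [lt_mem_nhds hσ] with x hx using verticalSlice_apply hH hx ψ

theorem hasDerivAt_verticalSlice_of_differentiableOn {I : TopologicalSpace.Opens ℝ} {F : ℂ → ℂ}
    (hF : DifferentiableOn ℂ F halfPlane) {σ : ℝ} (hσ : 1 < σ) (ψ : 𝓓(I, ℂ)) :
    HasDerivAt (fun σ => verticalSlice I F σ ψ)
      (Complex.I * verticalSlice I F σ (testDeriv ψ)) σ := by
  have hd : ∀ z ∈ halfPlane, HasDerivAt F (deriv F z) z := fun z hz =>
    (hF.differentiableAt (isOpen_halfPlane.mem_nhds hz)).hasDerivAt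
  refine hasDerivAt_verticalSlice (D := deriv F) Complex.I_mul_I hF.continuousOn
    (hF.deriv isOpen_halfPlane).continuousOn (fun σ hσ t => ?_) (fun σ hσ t => ?_) hσ ψ
  · have h := (hd _ (mem_halfPlane_of_one_lt hσ t)).scomp σ
      ((Complex.ofRealCLM.hasDerivAt (x := σ)).add_const (t * Complex.I))
    simpa using! h
  · have h := (hd _ (mem_halfPlane_of_one_lt hσ t)).scomp t
      (((Complex.ofRealCLM.hasDerivAt (x := t)).mul_const Complex.I).const_add (σ : ℂ))
    simpa using! h

/-- Conjugation replaces `i` by `-i`, which reverses the end at which the boundary value decays. -/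
theorem hasDerivAt_verticalSlice_conj_of_differentiableOn {I : TopologicalSpace.Opens ℝ}
    {F : ℂ → ℂ} (hF : DifferentiableOn ℂ F halfPlane) {σ : ℝ} (hσ : 1 < σ) (ψ : 𝓓(I, ℂ)) :
    HasDerivAt (fun σ => verticalSlice I (fun s => star (F s)) σ ψ)
      (-Complex.I * verticalSlice I (fun s => star (F s)) σ (testDeriv ψ)) σ := by
  have hd : ∀ z ∈ halfPlane, HasDerivAt F (deriv F z) z := fun z hz =>
    (hF.differentiableAt (isOpen_halfPlane.mem_nhds hz)).hasDerivAt
  refine hasDerivAt_verticalSlice (D := fun s => star (deriv F s)) (by simp)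
    hF.continuousOn.star (hF.deriv isOpen_halfPlane).continuousOn.star (fun σ hσ t => ?_)
    (fun σ hσ t => ?_) hσ ψ
  · have h := (hd _ (mem_halfPlane_of_one_lt hσ t)).scomp σ
      ((Complex.ofRealCLM.hasDerivAt (x := σ)).add_const (t * Complex.I))
    simpa using! h.star
  · have h := (hd _ (mem_halfPlane_of_one_lt hσ t)).scomp t
      (((Complex.ofRealCLM.hasDerivAt (x := t)).mul_const Complex.I).const_add (σ : ℂ))
    simpa using! h.star

theorem verticalSlice_add_const_mul {I : TopologicalSpace.Opens ℝ} {A B : ℂ → ℂ}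
    (hA : ContinuousOn A halfPlane) (hB : ContinuousOn B halfPlane) (c : ℂ) {σ : ℝ} (hσ : 1 < σ)
    (ψ : 𝓓(I, ℂ)) : verticalSlice I (fun s => A s + c * B s) σ ψ =
      verticalSlice I A σ ψ + c * verticalSlice I B σ ψ := by
  rw [verticalSlice_apply (H := fun s => A s + c * B s) (hA.add (continuousOn_const.mul hB)) hσ, verticalSlice_apply hA hσ,
    verticalSlice_apply hB hσ, ← integral_const_mul,
    ← integral_add (TestFunction.integrable_mul (hA.continuous_slice hσ) ψ)
      ((TestFunction.integrable_mul (hB.continuous_slice hσ) ψ).const_mul c)]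
  congr 1
  funext t
  ring

/-! ### Existence and rate of limits at `σ = 1` -/

theorem norm_sub_le_of_hasDerivAt_Ioc {g g' : ℝ → ℂ} {B : ℝ}
    (hg : ∀ σ > 1, HasDerivAt g (g' σ) σ) (hB : ∀ σ ∈ Set.Ioc (1 : ℝ) 2, ‖g' σ‖ ≤ B)
    {σ τ : ℝ} (hσ : σ ∈ Set.Ioc (1 : ℝ) 2) (hτ : τ ∈ Set.Ioc (1 : ℝ) 2) :
    ‖g τ - g σ‖ ≤ B * |τ - σ| :=
  (convex_Ioc (1 : ℝ) 2).norm_image_sub_le_of_norm_hasDerivWithin_le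
    (fun x hx => (hg x hx.1).hasDerivWithinAt) hB hσ hτ

/-- A function on `(1, 2]` with bounded derivative has a limit at `1`. -/
theorem exists_tendsto_of_hasDerivAt_Ioc {g g' : ℝ → ℂ} {B : ℝ}
    (hg : ∀ σ > 1, HasDerivAt g (g' σ) σ) (hB : ∀ σ ∈ Set.Ioc (1 : ℝ) 2, ‖g' σ‖ ≤ B) :
    ∃ a, Tendsto g (𝓝[>] 1) (𝓝 a) := by
  have hB0 : 0 ≤ B := (norm_nonneg _).trans (hB 2 (by norm_num))
  rw [← cauchy_map_iff_exists_tendsto, Metric.cauchy_iff]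
  refine ⟨inferInstance, fun ε hε => ?_⟩
  -- `B + 1` rather than `B`, since `B` may be zero.
  have hδ : 0 < ε / (B + 1) := by positivity
  refine ⟨g '' (Set.Ioc 1 2 ∩ Set.Iio (1 + ε / (B + 1))), image_mem_map (inter_mem
    (Ioc_mem_nhdsGT (by norm_num)) (mem_nhdsWithin_of_mem_nhds (Iio_mem_nhds (by linarith)))), ?_⟩
  rintro _ ⟨τ, ⟨hτ, hτ'⟩, rfl⟩ _ ⟨σ, ⟨hσ, hσ'⟩, rfl⟩
  rw [dist_eq_norm]
  have hlt : |τ - σ| < ε / (B + 1) := by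
    rw [abs_lt]
    constructor <;> linarith [hτ.1, hσ.1, Set.mem_Iio.1 hτ', Set.mem_Iio.1 hσ']
  calc ‖g τ - g σ‖ ≤ B * |τ - σ| := norm_sub_le_of_hasDerivAt_Ioc hg hB hσ hτ
    _ ≤ (B + 1) * |τ - σ| := by gcongr; linarith
    _ < (B + 1) * (ε / (B + 1)) := by gcongr
    _ = ε := by field_simp

/-- The explicit rate is what makes convergence locally uniform in the frequency. -/
theorem norm_sub_limit_le_of_hasDerivAt_Ioc {g g' : ℝ → ℂ} {B : ℝ} {a : ℂ}
    (hg : ∀ σ > 1, HasDerivAt g (g' σ) σ) (hB : ∀ σ ∈ Set.Ioc (1 : ℝ) 2, ‖g' σ‖ ≤ B)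
    (ha : Tendsto g (𝓝[>] 1) (𝓝 a)) {σ : ℝ} (hσ : σ ∈ Set.Ioc (1 : ℝ) 2) :
    ‖a - g σ‖ ≤ B * (σ - 1) := by
  have hB0 : 0 ≤ B := (norm_nonneg _).trans (hB 2 (by norm_num))
  refine le_of_tendsto (ha.sub_const (g σ)).norm ?_
  filter_upwards [Ioc_mem_nhdsGT hσ.1] with τ hτ
  refine (norm_sub_le_of_hasDerivAt_Ioc hg hB hσ ⟨hτ.1, hτ.2.trans hσ.2⟩).trans ?_
  gcongr
  rw [abs_le]
  constructor <;> linarith [hτ.1, hτ.2]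

/-- The pointwise limit of distributions is a distribution. -/
theorem ComplexDistribution.exists_of_tendsto {I : TopologicalSpace.Opens ℝ}
    {T : ℝ → ComplexDistribution I} (h : ∀ ψ, ∃ a, Tendsto (fun σ => T σ ψ) (𝓝[>] 1) (𝓝 a)) :
    ∃ v : ComplexDistribution I, ∀ ψ, Tendsto (fun σ => T σ ψ) (𝓝[>] 1) (𝓝 (v ψ)) := by
  choose v hv using h
  refine ⟨TestFunction.mkCLM ℂ v (fun φ ψ => ?_) (fun c φ => ?_) (fun K hK => ?_), hv⟩
  · refine tendsto_nhds_unique (hv (φ + ψ)) ?_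
    simpa only [map_add] using (hv φ).add (hv ψ)
  · refine tendsto_nhds_unique (hv (c • φ)) ?_
    simpa only [map_smul] using (hv φ).const_smul c
  -- Continuity is tested on each `𝓓_{K}`, where Banach–Steinhaus makes a pointwise limit
  -- continuous.
  · have := ContDiffMapSupportedIn.baireSpace (E := ℝ) (F := ℂ) (K := K)
    exact (continuousLinearMapOfTendsto (l := 𝓝[>] (1 : ℝ))
      (fun σ => (T σ).comp (TestFunction.ofSupportedInCLM ℂ hK))
      (f := v ∘ TestFunction.ofSupportedIn hK)
      (tendsto_pi_nhds.2 fun ψ => hv (TestFunction.ofSupportedIn hK ψ))).continuous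

/-! ### The harmonic conjugate -/

theorem mainTheorem7 (I : TopologicalSpace.Opens ℝ) (U : ℂ → ℝ)
    (hU : InnerProductSpace.HarmonicOnNhd U halfPlane)
    (hpf : HasLocalPseudofunctionBoundary I (fun s => (U s : ℂ)))
    (V : ℂ → ℝ) (hV : IsHarmonicConjugateOn U V halfPlane) :
    HasLocalPseudofunctionBoundary I (fun s => (V s : ℂ)) := by
  obtain ⟨u, hu, hupf⟩ := hpf
  set F : ℂ → ℂ := fun s => (U s : ℂ) + Complex.I * (V s : ℂ) with hFdef
  have hF : DifferentiableOn ℂ F halfPlane := hV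
  have hUre : (fun s => (U s : ℂ)) = fun s => ((F s).re : ℂ) := by
    funext s; simp [hFdef]
  have hVim : (fun s => (V s : ℂ)) = fun s => ((F s).im : ℂ) := by
    funext s; simp [hFdef]
  have hUc : ContinuousOn (fun s => (U s : ℂ)) halfPlane := by
    rw [hUre]
    exact (Complex.continuous_ofReal.comp Complex.continuous_re).comp_continuousOn hF.continuousOn
  have hVc : ContinuousOn (fun s => (V s : ℂ)) halfPlane := by
    rw [hVim]
    exact (Complex.continuous_ofReal.comp Complex.continuous_im).comp_continuousOn hF.continuousOn
  have hstar : (fun s => star (F s)) = fun s => (U s : ℂ) + -Complex.I * (V s : ℂ) := by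
    funext s; simp [hFdef]
  set TU := verticalSlice I fun s => (U s : ℂ) with hTU
  set TV := verticalSlice I fun s => (V s : ℂ) with hTV
  set TF := verticalSlice I F with hTF
  set TC := verticalSlice I fun s => star (F s) with hTC
  have hFeq : ∀ σ > 1, ∀ ψ, TF σ ψ = TU σ ψ + Complex.I * TV σ ψ := fun σ hσ ψ =>
    verticalSlice_add_const_mul hUc hVc Complex.I hσ ψ
  have hCeq : ∀ σ > 1, ∀ ψ, TC σ ψ = TU σ ψ + -Complex.I * TV σ ψ := fun σ hσ ψ => by
    rw [hTC, hstar]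
    exact verticalSlice_add_const_mul hUc hVc (-Complex.I) hσ ψ
  have hFd : ∀ σ > 1, ∀ ψ, HasDerivAt (fun σ => TF σ ψ) (Complex.I * TF σ (testDeriv ψ)) σ :=
    fun σ hσ ψ => hasDerivAt_verticalSlice_of_differentiableOn hF hσ ψ
  have hCd : ∀ σ > 1, ∀ ψ, HasDerivAt (fun σ => TC σ ψ) (-Complex.I * TC σ (testDeriv ψ)) σ :=
    fun σ hσ ψ => hasDerivAt_verticalSlice_conj_of_differentiableOn hF hσ ψ
  -- Taking the imaginary part of `F` swaps the sum and the difference of the two equations, so the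
  -- derivative involves `U` alone.
  have hVd : ∀ ψ, ∀ σ > 1, HasDerivAt (fun σ => TV σ ψ) (TU σ (testDeriv ψ)) σ := by
    intro ψ σ hσ
    have h := ((hFd σ hσ ψ).sub (hCd σ hσ ψ)).const_mul (-Complex.I / 2)
    refine (h.congr_deriv ?_).congr_of_eventuallyEq ?_
    · rw [hFeq σ hσ, hCeq σ hσ]
      linear_combination (-TU σ (testDeriv ψ)) * Complex.I_sq
    · filter_upwards [lt_mem_nhds hσ] with x hx
      simp only [Pi.sub_apply, hFeq x hx, hCeq x hx]
      linear_combination (TV x ψ) * Complex.I_sq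
  have hUd : ∀ ψ, ContinuousOn (fun σ => TU σ ψ) (Set.Ioi 1) := by
    intro ψ
    have h : ContinuousOn (fun σ => (TF σ ψ + TC σ ψ) / 2) (Set.Ioi 1) := fun σ hσ =>
      (((hFd σ hσ ψ).continuousAt.add (hCd σ hσ ψ).continuousAt).div_const 2).continuousWithinAt
    refine h.congr fun σ hσ => ?_
    simp only [hFeq σ hσ, hCeq σ hσ]
    ring
  have hUlim : ∀ ψ, Tendsto (fun σ => TU σ ψ) (𝓝[>] 1) (𝓝 (u ψ)) := fun ψ =>
    (hu ψ).congr' (eventually_mem_nhdsWithin.mono fun σ hσ => (verticalSlice_apply hUc hσ ψ).symm)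
  obtain ⟨v, hv⟩ := ComplexDistribution.exists_of_tendsto (T := TV) fun ψ => by
    obtain ⟨C, hC⟩ := exists_norm_le_Ioc_of_tendsto (hUd (testDeriv ψ)) (hUlim (testDeriv ψ))
    exact exists_tendsto_of_hasDerivAt_Ioc (hVd ψ) hC
  refine ⟨v, fun φ => (hv φ).congr' (eventually_mem_nhdsWithin.mono fun σ hσ =>
    verticalSlice_apply hVc hσ φ), fun φ => ⟨?_, ?_, ?_⟩⟩
  · obtain ⟨M, hM⟩ := ComplexDistribution.exists_bound_modulate
      (fun i : Set.Ioc (1 : ℝ) 2 => (TU i).comp testDeriv)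
      (fun ψ => ComplexDistribution.exists_bound_Ioc hUd hUlim (testDeriv ψ))
      (K := ⟨tsupport φ, φ.hasCompactSupport⟩) φ.tsupport_subset
    obtain ⟨C, hC0, hC⟩ := hM φ subset_rfl
    have hloc : TendstoLocallyUniformly (fun σ ξ => TV σ (modulate φ ξ)) (localizedFourier v φ)
        (𝓝[>] (1 : ℝ)) := by
      rw [Metric.tendstoLocallyUniformly_iff]
      intro ε hε ξ₀
      have hcont : Continuous fun ξ : ℝ => C * (1 + |ξ|) ^ M := by fun_prop
      -- The added `1` makes `R` exceed the rate constant on a whole neighbourhood of `ξ₀`.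
      set R := C * (1 + |ξ₀|) ^ M + 1 with hR
      have hR0 : 0 < R := by positivity
      refine ⟨{ξ | C * (1 + |ξ|) ^ M < R},
        (hcont.tendsto ξ₀).eventually_lt_const (by linarith), ?_⟩
      filter_upwards [Ioc_mem_nhdsGT (show (1 : ℝ) < 2 by norm_num),
        mem_nhdsWithin_of_mem_nhds (Iio_mem_nhds (show (1 : ℝ) < 1 + ε / R by
          have : 0 < ε / R := by positivity
          linarith))] with σ hσ hσ' ξ hξ
      rw [dist_eq_norm]
      have hbd := norm_sub_limit_le_of_hasDerivAt_Ioc (hVd (modulate φ ξ))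
        (fun τ hτ => hC ⟨τ, hτ⟩ ξ) (hv (modulate φ ξ)) hσ
      have hσ0 : 0 < σ - 1 := by linarith [hσ.1]
      calc ‖localizedFourier v φ ξ - TV σ (modulate φ ξ)‖ ≤ C * (1 + |ξ|) ^ M * (σ - 1) := hbd
        _ ≤ R * (σ - 1) := by
          have : C * (1 + |ξ|) ^ M ≤ R := le_of_lt hξ
          gcongr
        _ < R * (ε / R) := by
          have : σ - 1 < ε / R := by linarith [Set.mem_Iio.1 hσ']
          gcongr
        _ = ε := by field_simp
    have hcont : ∀ᶠ σ in 𝓝[>] (1 : ℝ), Continuous fun ξ => TV σ (modulate φ ξ) :=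
      eventually_mem_nhdsWithin.mono fun σ hσ => continuous_verticalSlice_modulate hVc hσ φ
    exact hloc.continuous hcont.frequently
  · have h := tendsto_modulate_of_hasDerivAt (T := TF) (ε := 1) (by norm_num)
      (by simpa using hFd) (f := fun ψ => u ψ + Complex.I * v ψ) (fun ψ =>
        ((hUlim ψ).add ((hv ψ).const_mul Complex.I)).congr'
          (eventually_mem_nhdsWithin.mono fun σ hσ => (hFeq σ hσ ψ).symm)) φ
    -- `v = -i((u + iv) - u)`, and both transforms on the right decay at `+∞`.
    have h2 := (h.sub (hupf φ).2.1).const_mul (-Complex.I)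
    simp only [sub_zero, mul_zero] at h2
    refine h2.congr fun ξ => ?_
    simp only [localizedFourier, one_mul]
    linear_combination (-v (modulate φ ξ)) * Complex.I_sq
  -- With `ε = -1` the modulation is by `-l`; substituting `l = -ξ` covers `ξ → -∞`.
  · have h := (tendsto_modulate_of_hasDerivAt (T := TC) (ε := -1) (by norm_num)
      (by simpa using hCd) (f := fun ψ => u ψ + -Complex.I * v ψ) (fun ψ =>
        ((hUlim ψ).add ((hv ψ).const_mul (-Complex.I))).congr'
          (eventually_mem_nhdsWithin.mono fun σ hσ => (hCeq σ hσ ψ).symm)) φ).comp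
      tendsto_neg_atBot_atTop
    have h2 := (h.sub (hupf φ).2.2).const_mul Complex.I
    simp only [sub_zero, mul_zero] at h2
    refine h2.congr fun ξ => ?_
    simp only [localizedFourier, Function.comp_apply, neg_mul, one_mul, neg_neg]
    linear_combination (-v (modulate φ ξ)) * Complex.I_sq
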